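/- Let $X$ be a complex Banach space, let $L(X)$ be the algebra of bounded linear operators on $X$, and write $R(S)$, $N(S)$ for the range and the kernel of $S\in L(X)$. An operator $S\in L(X)$ is *of topological uniform descent* if there is an integer $d\ge 0$ such that $R(S)+N(S^n)=R(S)+N(S^d)$ for all $n\ge d$ and $R(S)+N(S^d)$ is closed. It is *B-Fredholm* if there is an integer $n\ge 0$ such that $R(S^n)$ is closed and the operator $R(S^n)\to R(S^n)$ induced by $S$ is a Fredholm operator (its kernel has finite dimension and its range has finite codimension). For $T\in L(X)$ put $$\sigma_{TUD}(T)=\{\lambda\in\mathbb{C} : T-\lambda I \text{ is not of topological uniform descent}\},$$ $$\sigma_{BF}(T)=\{\lambda\in\mathbb{C} : T-\lambda I \text{ is not B-Fredholm}\}.$$ Let $\mathfrak{F}\subset L(X)$ be the class of those $T\in L(X)$ whose spectrum $\sigma(T)$ is a finite (possibly empty, if $X=0$) set all of whose points are poles of the resolvent $\mu\mapsto (T-\mu I)^{-1}$. Theorem. $$\mathfrak{F}=\{T\in L(X) : \sigma_{TUD}(T)=\emptyset\}=\{T\in L(X) : \sigma_{BF}(T)=\emptyset\}.$$ -/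

import Mathlib

/-- `T` maps the range of `T ^ n` into itself. -/
theorem mapsTo_range_pow {X : Type*} [NormedAddCommGroup X] [NormedSpace ℂ X]
    (T : X →L[ℂ] X) (n : ℕ) :
    Set.MapsTo T ((T ^ n).range : Set X) ((T ^ n).range : Set X) := by
  rintro x ⟨y, rfl⟩
  refine ⟨T y, ?_⟩
  change (T ^ n * T) y = (T * T ^ n) y
  rw [← pow_succ, ← pow_succ']

/-- The operator `T_n : R(T ^ n) → R(T ^ n)` induced by `T` on the range of `T ^ n`. -/
def restrictRangePow {X : Type*} [NormedAddCommGroup X] [NormedSpace ℂ X]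
    (T : X →L[ℂ] X) (n : ℕ) : (T ^ n).range →L[ℂ] (T ^ n).range :=
  T.restrict (mapsTo_range_pow T n)

/-- `T` is a B-Fredholm operator: for some `n`, the range of `T ^ n` is closed and the operator
induced by `T` on this range is a Fredholm operator. -/
def IsBFredholm {X : Type*} [NormedAddCommGroup X] [NormedSpace ℂ X] (T : X →L[ℂ] X) : Prop :=
  ∃ n : ℕ, IsClosed ((T ^ n).range : Set X) ∧ (restrictRangePow T n).IsFredholm

/-- `T` has uniform descent for `n ≥ d`: `R(T) + N(T ^ n) = R(T) + N(T ^ d)` for all `n ≥ d`. -/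
def HasUniformDescent {X : Type*} [NormedAddCommGroup X] [NormedSpace ℂ X]
    (T : X →L[ℂ] X) (d : ℕ) : Prop :=
  ∀ n : ℕ, d ≤ n → T.range ⊔ (T ^ n).ker = T.range ⊔ (T ^ d).ker

/-- `T` is an operator of topological uniform descent: for some `d`, `T` has uniform descent for
`n ≥ d` and `R(T) + N(T ^ d)` is closed. -/
def IsTopologicalUniformDescent {X : Type*} [NormedAddCommGroup X] [NormedSpace ℂ X]
    (T : X →L[ℂ] X) : Prop :=
  ∃ d : ℕ, HasUniformDescent T d ∧ IsClosed ((T.range ⊔ (T ^ d).ker : Submodule ℂ X) : Set X)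

/-- The topological uniform descent spectrum of `T`. -/
def tudSpectrum {X : Type*} [NormedAddCommGroup X] [NormedSpace ℂ X] (T : X →L[ℂ] X) : Set ℂ :=
  {μ : ℂ | ¬ IsTopologicalUniformDescent (T - μ • (1 : X →L[ℂ] X))}

/-- The B-Fredholm spectrum of `T`. -/
def bFredholmSpectrum {X : Type*} [NormedAddCommGroup X] [NormedSpace ℂ X]
    (T : X →L[ℂ] X) : Set ℂ :=
  {μ : ℂ | ¬ IsBFredholm (T - μ • (1 : X →L[ℂ] X))}

/-- `μ` is a pole of the resolvent of `T`: the function `z ↦ (z - T)⁻¹` (with value `0` on the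
spectrum) is meromorphic at `μ`, of negative order. As the order is neither `≥ 0` nor infinite,
this function is nonzero near `μ`, so that `μ` is an isolated point of the spectrum. -/
def IsResolventPole {X : Type*} [NormedAddCommGroup X] [NormedSpace ℂ X]
    (T : X →L[ℂ] X) (μ : ℂ) : Prop :=
  MeromorphicAt (resolvent T : ℂ → X →L[ℂ] X) μ ∧
    meromorphicOrderAt (resolvent T : ℂ → X →L[ℂ] X) μ < 0

/-- The class of the bounded operators on `X` whose spectrum is a finite set of poles of the
resolvent. -/
def finitePoleClass (X : Type*) [NormedAddCommGroup X] [NormedSpace ℂ X] : Set (X →L[ℂ] X) :=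
  {T : X →L[ℂ] X | (spectrum ℂ T).Finite ∧ ∀ μ ∈ spectrum ℂ T, IsResolventPole T μ}

/-! Write `S = T - μ`. At a pole or a regular point, `S` is Drazin invertible: `S ^ p = S ^ (p + 1)
* Q` with `Q` commuting with `S` (`exists_commute_pow_eq_of_meromorphicAt`). This algebraic identity
yields both B-Fredholmness and topological uniform descent, and B-Fredholm operators always have the
latter.

It remains to recover poles from uniform descent. Let μ be a frontier point of the spectrum and `A`
the operator induced by `S` on `X / N(S ^ d)`. Then `A` has closed range containing every `N(A ^
n)`, and arbitrarily small translates of `A` are invertible; this forces `A` to be invertible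
(`isUnit_of_hasUniformDescent`). As `S ^ d` factors through the quotient, the resolvent of `T` near
μ is `(z - μ) ^ (-d)` times an analytic function. So frontier points are isolated, and a compact
subset of ℂ with this property is finite. -/

open Filter Topology

/-! ### Resolvent singularities in a Banach algebra -/

section BanachAlgebra

variable {A : Type*} [NormedRing A] [NormedAlgebra ℂ A]

/-- If `(w - s) h(w) = a` near `0` with `h` analytic at `0` and commuting with `s`, then `a` is
divisible by every power of `s` within the commutant of `s`. -/
theorem exists_commute_eq_pow_mul (s : A) (k : ℕ) (a : A) (h : ℂ → A) (hh : AnalyticAt ℂ h 0)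
    (hs : ∀ᶠ w in 𝓝[≠] (0 : ℂ), (w • (1 : A) - s) * h w = a ∧ Commute s (h w)) :
    ∃ b, Commute s b ∧ a = s ^ k * b := by
  induction k generalizing a h with
  | zero =>
    obtain ⟨w, hw, hc⟩ := hs.exists
    refine ⟨a, ?_, by simp⟩
    rw [← hw]
    exact (((Commute.one_right s).smul_right w).sub_right (Commute.refl s)).mul_right hc
  | succ k ih =>
    have ht : Tendsto h (𝓝[≠] 0) (𝓝 (h 0)) := hh.continuousAt.tendsto.mono_left nhdsWithin_le_nhds
    have hid : Tendsto (fun w : ℂ => w • (1 : A)) (𝓝[≠] 0) (𝓝 ((0 : ℂ) • (1 : A))) :=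
      (Continuous.tendsto (by fun_prop) 0).mono_left nhdsWithin_le_nhds
    have hc0 : Commute s (h 0) :=
      tendsto_nhds_unique ((ht.const_mul s).congr' (hs.mono fun w hw => hw.2)) (ht.mul_const s)
    have ha : a = -(s * h 0) := by
      have h1 := (hid.sub_const s).mul ht
      have h2 := tendsto_nhds_unique
        (h1.congr' (hs.mono fun w hw => hw.1)) tendsto_const_nhds
      rw [← h2]; simp
    obtain ⟨p, hp⟩ := hh
    -- Since `a = -s * h 0`, we get `(w - s) * (h w - h 0) = -w • h 0`, so the negated difference
    -- quotient solves the same equation with `h 0` in place of `a`.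
    obtain ⟨b, hb, hb'⟩ := ih (h 0) (fun w => -dslope h 0 w)
      hp.has_fpower_series_dslope_fslope.analyticAt.neg (by
        filter_upwards [hs, self_mem_nhdsWithin] with w hw hw0
        have hw0 : w ≠ 0 := hw0
        have e : dslope h 0 w = w⁻¹ • (h w - h 0) := by
          rw [dslope_of_ne h hw0, slope_def_module]; simp
        rw [e]
        refine ⟨?_, ((hw.2.sub_right hc0).smul_right _).neg_right⟩
        have e2 : (w • (1 : A) - s) * (h w - h 0) = -(w • h 0) := by
          rw [mul_sub, hw.1, ha, sub_mul, smul_mul_assoc, one_mul]; abel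
        rw [mul_neg, mul_smul_comm, e2, smul_neg, neg_neg, inv_smul_smul₀ hw0])
    exact ⟨-b, hb.neg_right, by rw [ha, hb', pow_succ', mul_neg, mul_assoc]⟩

/-- At an isolated singularity where the resolvent is meromorphic, `T - μ` is Drazin invertible. -/
theorem exists_commute_pow_eq_of_meromorphicAt (T : A) (μ : ℂ)
    (hm : MeromorphicAt (resolvent T : ℂ → A) μ) (hr : ∀ᶠ z in 𝓝[≠] μ, z ∉ spectrum ℂ T) :
    ∃ (p : ℕ) (Q : A), Commute (T - μ • (1 : A)) Q ∧
      (T - μ • (1 : A)) ^ p = (T - μ • (1 : A)) ^ (p + 1) * Q := by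
  obtain ⟨n, hn⟩ := hm
  set s := T - μ • (1 : A) with hs
  let E : ℂ → A := fun w => ∑ i ∈ Finset.range n, (w • (1 : A)) ^ i * s ^ (n - 1 - i)
  have hE : AnalyticAt ℂ E 0 := by fun_prop
  have hcE : ∀ w, Commute s (E w) := fun w => Commute.sum_right _ _ _ fun i _ =>
    (((Commute.one_right s).smul_right w).pow_right i).mul_right ((Commute.refl s).pow_right _)
  have hmE : ∀ w : ℂ, (w • (1 : A) - s) * E w = w ^ n • (1 : A) - s ^ n := fun w => by
    have := ((Commute.one_left s).smul_left w).mul_geom_sum₂ n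
    rw [this, smul_pow, one_pow]
  have hG : AnalyticAt ℂ (fun w : ℂ => w ^ n • resolvent T (μ + w)) 0 := by
    have h1 : AnalyticAt ℂ (fun w : ℂ => μ + w) 0 := by fun_prop
    have h2 := AnalyticAt.comp_of_eq (f := fun w : ℂ => μ + w) hn h1 (by simp)
    simpa [Function.comp_def] using h2
  have hr0 : ∀ᶠ w in 𝓝[≠] (0 : ℂ), μ + w ∉ spectrum ℂ T := by
    have : Tendsto (fun w : ℂ => μ + w) (𝓝[≠] 0) (𝓝[≠] μ) := by
      refine tendsto_nhdsWithin_of_tendsto_nhds_of_eventually_within _ ?_ ?_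
      · have : Tendsto (fun w : ℂ => μ + w) (𝓝 0) (𝓝 (μ + 0)) := Continuous.tendsto (by fun_prop) 0
        rw [add_zero] at this
        exact this.mono_left nhdsWithin_le_nhds
      · filter_upwards [self_mem_nhdsWithin] with w hw
        simpa using hw
    exact this.eventually hr
  -- As `(w - s) * E w = w ^ n - s ^ n`, subtracting `E` cancels `w ^ n` and leaves the constant `s
  -- ^ n`.
  obtain ⟨b, hb, hb'⟩ := exists_commute_eq_pow_mul s (n + 1) (s ^ n)
    (fun w => w ^ n • resolvent T (μ + w) - E w) (hG.sub hE) (by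
      filter_upwards [hr0] with w hw
      have e : algebraMap ℂ A (μ + w) - T = w • (1 : A) - s := by
        rw [Algebra.algebraMap_eq_smul_one, hs, add_smul]; abel
      have hu : IsUnit (w • (1 : A) - s) := by
        rw [← e]; exact spectrum.notMem_iff.mp hw
      have hres : resolvent T (μ + w) = Ring.inverse (w • (1 : A) - s) := by rw [resolvent, e]
      refine ⟨?_, ?_⟩
      · rw [mul_sub, hmE, hres, mul_smul_comm, Ring.mul_inverse_cancel _ hu]
        abel
      · rw [hres]
        refine Commute.sub_right (Commute.smul_right ?_ _) (hcE w)
        have hsu : Commute s (w • (1 : A) - s) :=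
          ((Commute.one_right s).smul_right w).sub_right (Commute.refl s)
        obtain ⟨u, hu⟩ := hu
        rw [← hu] at hsu ⊢
        rw [Ring.inverse_unit]
        exact hsu.units_inv_right)
  exact ⟨n, b, hb, hb'⟩

/-- A spectral point which is an isolated singularity and at which the resolvent is meromorphic is
a pole. -/
theorem meromorphicOrderAt_resolvent_neg {T : A} {μ : ℂ} (hμ : μ ∈ spectrum ℂ T)
    (hm : MeromorphicAt (resolvent T : ℂ → A) μ) (hr : ∀ᶠ z in 𝓝[≠] μ, z ∉ spectrum ℂ T) :
    meromorphicOrderAt (resolvent T : ℂ → A) μ < 0 := by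
  by_contra! h
  -- With nonnegative order the resolvent has a limit at μ, which would invert `μ - T`.
  obtain ⟨c, hc⟩ := tendsto_nhds_of_meromorphicOrderAt_nonneg hm h
  have hid : Tendsto (fun z : ℂ => algebraMap ℂ A z - T) (𝓝[≠] μ) (𝓝 (algebraMap ℂ A μ - T)) :=
    (Continuous.tendsto (by fun_prop) μ).mono_left nhdsWithin_le_nhds
  refine spectrum.mem_iff.mp hμ (isUnit_iff_exists.mpr ⟨c, ?_, ?_⟩)
  · refine tendsto_nhds_unique ((hid.mul hc).congr' ?_) tendsto_const_nhds
    filter_upwards [hr] with z hz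
    exact Ring.mul_inverse_cancel _ (spectrum.notMem_iff.mp hz)
  · refine tendsto_nhds_unique ((hc.mul hid).congr' ?_) tendsto_const_nhds
    filter_upwards [hr] with z hz
    exact Ring.inverse_mul_cancel _ (spectrum.notMem_iff.mp hz)

/-- A compact subset of `ℂ` whose frontier points are isolated is finite and equal to its
frontier. -/
theorem finite_and_subset_frontier_of_isolated {K : Set ℂ} (hK : IsCompact K)
    (h : ∀ μ ∈ frontier K, ∀ᶠ z in 𝓝[≠] μ, z ∉ K) : K.Finite ∧ K ⊆ frontier K := by
  -- Interior points cannot accumulate at an isolated frontier point, so the interior is clopen in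
  -- the connected, noncompact plane.
  have hclosed : IsClosed (interior K) := by
    rw [← isOpen_compl_iff, isOpen_iff_mem_nhds]
    intro x hx
    by_cases hxK : x ∈ K
    · have hf : x ∈ frontier K := ⟨subset_closure hxK, hx⟩
      filter_upwards [eventually_nhdsWithin_iff.mp (h x hf)] with z hz hzi
      by_cases hzx : z = x
      · exact hx (hzx ▸ hzi)
      · exact hz hzx (interior_subset hzi)
    · filter_upwards [hK.isClosed.isOpen_compl.mem_nhds hxK] with z hz hzi
      exact hz (interior_subset hzi)
  have hempty : interior K = ∅ := by
    rcases isClopen_iff.mp ⟨hclosed, isOpen_interior⟩ with h0 | h0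
    · exact h0
    · exact absurd (Set.univ_subset_iff.mp (h0 ▸ interior_subset) ▸ hK : IsCompact (Set.univ : Set ℂ))
        (noncompact_univ ℂ)
  have hsub : K ⊆ frontier K := by
    rw [hK.isClosed.frontier_eq, hempty, Set.sdiff_empty]
  refine ⟨?_, hsub⟩
  by_contra hinf
  obtain ⟨x, hx, hacc⟩ := Set.Infinite.exists_accPt_of_subset_isCompact hinf hK subset_rfl
  obtain ⟨z, hz⟩ := ((accPt_iff_frequently_nhdsNE.mp hacc).and_eventually (h x (hsub hx))).exists
  exact hz.2 hz.1

end BanachAlgebra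

/-! ### Drazin invertibility, B-Fredholm operators and uniform descent -/

section DrazinBFredholm

variable {X : Type*} [NormedAddCommGroup X] [NormedSpace ℂ X]

/-- For `n ≥ p`, `S ^ n * (1 - S * Q) = 0`, so `x = S Q x + (x - S Q x)` shows that the sum of range
and kernel is all of `X`. -/
theorem isTopologicalUniformDescent_of_pow_eq {S Q : X →L[ℂ] X} {p : ℕ}
    (h : S ^ p = S ^ (p + 1) * Q) : IsTopologicalUniformDescent S := by
  have key : ∀ n, p ≤ n → S.range ⊔ (S ^ n).ker = ⊤ := by
    intro n hn
    rw [eq_top_iff]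
    intro x _
    refine Submodule.mem_sup.mpr ⟨S (Q x), ⟨Q x, rfl⟩, x - S (Q x), ?_, by abel⟩
    obtain ⟨k, rfl⟩ := Nat.exists_eq_add_of_le' hn
    have e : S ^ (k + p) * (1 - S * Q) = 0 := by
      rw [mul_sub, mul_one, ← mul_assoc, ← pow_succ, add_assoc, pow_add, pow_add, mul_assoc, ← h,
        sub_self]
    exact congr($e x)
  exact ⟨p, fun n hn => by rw [key n hn, key p le_rfl], by rw [key p le_rfl]; exact isClosed_univ⟩

/-- Iteration gives `S ^ p = S ^ (2 * p) * Q ^ p`, so `R(S ^ p)` is the fixed space of `S ^ p * Q ^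
p`, hence closed; on it `S` is bijective, with inverse induced by `Q`. -/
theorem isBFredholm_of_pow_eq [CompleteSpace X] {S Q : X →L[ℂ] X} {p : ℕ} (hc : Commute S Q)
    (h : S ^ p = S ^ (p + 1) * Q) : IsBFredholm S := by
  have hk : ∀ k, S ^ p = S ^ (p + k) * Q ^ k := by
    intro k
    induction k with
    | zero => simp
    | succ k ih =>
      rw [show p + (k + 1) = k + (p + 1) by omega, pow_add, pow_succ' Q, mul_assoc,
        ← mul_assoc (S ^ (p + 1)), ← h, ← mul_assoc, ← pow_add, add_comm k p]
      exact ih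
  have hcl : IsClosed ((S ^ p).range : Set X) := by
    have e : ((S ^ p).range : Set X) = {x | (S ^ p * Q ^ p) x = x} := by
      ext x
      constructor
      · rintro ⟨y, rfl⟩
        have h1 : S ^ p * Q ^ p * S ^ p = S ^ p := by
          rw [mul_assoc, ← (hc.pow_pow p p).eq, ← mul_assoc, ← pow_add, ← hk]
        exact congr($h1 y)
      · intro hx
        exact ⟨(Q ^ p) x, hx⟩
    rw [e]
    exact isClosed_eq (S ^ p * Q ^ p).continuous continuous_id
  have hcomp : CompleteSpace (S ^ p).range := hcl.completeSpace_coe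
  refine ⟨p, hcl, ?_⟩
  have hbij : Function.Bijective (restrictRangePow S p) := by
    constructor
    · rw [injective_iff_map_eq_zero]
      rintro ⟨_, y, rfl⟩ hy
      have hy' : S ((S ^ p) y) = 0 := congr(($hy : X))
      have e : S ^ p = Q * (S * S ^ p) := by
        rw [← pow_succ', ← (hc.pow_left (p + 1)).eq, ← h]
      apply Subtype.ext
      change (S ^ p) y = 0
      rw [e]
      change Q (S ((S ^ p) y)) = 0
      rw [hy', map_zero]
    · rintro ⟨_, y, rfl⟩
      refine ⟨⟨(S ^ p) (Q y), Q y, rfl⟩, Subtype.ext ?_⟩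
      have e : S * S ^ p * Q = S ^ p := by rw [← pow_succ', ← h]
      exact congr($e y)
  let e := ContinuousLinearEquiv.ofBijective (restrictRangePow S p)
    (LinearMap.ker_eq_bot.mpr hbij.1) (LinearMap.range_eq_top.mpr hbij.2)
  exact ContinuousLinearMap.IsFredholm.of_isQuasiInverse (v := (e.symm : _ →L[ℂ] _))
    e.toLinearEquiv.isQuasiInverse

theorem ContinuousLinearMap.IsFredholm.pow {Y : Type*} [NormedAddCommGroup Y] [NormedSpace ℂ Y]
    {U : Y →L[ℂ] Y} (hU : U.IsFredholm) (k : ℕ) : (U ^ k).IsFredholm := by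
  obtain ⟨V, hV⟩ := hU.exists_isQuasiInverse
  suffices h : ((V ^ k : Y →L[ℂ] Y) : Y →ₗ[ℂ] Y).IsQuasiInverse ((U ^ k : Y →L[ℂ] Y) : Y →ₗ[ℂ] Y) from
    .of_isQuasiInverse h
  induction k with
  | zero => exact (ContinuousLinearEquiv.refl ℂ Y).toLinearEquiv.isQuasiInverse
  | succ k ih =>
    rw [pow_succ V, pow_succ' U]
    exact ih.comp hV

theorem coe_restrictRangePow_pow_apply (S : X →L[ℂ] X) (n k : ℕ) (y : (S ^ n).range) :
    (((restrictRangePow S n) ^ k) y : X) = (S ^ k) y := by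
  induction k generalizing y with
  | zero => rfl
  | succ k ih =>
    rw [pow_succ, pow_succ]
    exact ih _

theorem isClosed_range_pow_of_isFredholm {S : X →L[ℂ] X} {n : ℕ}
    (hcl : IsClosed ((S ^ n).range : Set X)) (hF : (restrictRangePow S n).IsFredholm) (k : ℕ) :
    IsClosed ((S ^ (k + n)).range : Set X) := by
  have h1 := hcl.isClosedEmbedding_subtypeVal.isClosedMap _ (hF.pow k).isClosed_range
  convert h1 using 1
  ext x
  constructor
  · rintro ⟨y, rfl⟩
    refine ⟨_, ⟨⟨(S ^ n) y, y, rfl⟩, rfl⟩, ?_⟩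
    exact (coe_restrictRangePow_pow_apply S n k _).trans (by rw [pow_add]; rfl)
  · rintro ⟨_, ⟨⟨_, y, rfl⟩, rfl⟩, rfl⟩
    refine ⟨y, ?_⟩
    exact ((coe_restrictRangePow_pow_apply S n k _).trans (by rw [pow_add]; rfl)).symm

theorem range_pow_antitone (S : X →L[ℂ] X) : Antitone fun n => (S ^ n).range := by
  refine antitone_nat_of_succ_le fun n => ?_
  rintro _ ⟨y, rfl⟩
  exact ⟨S y, by rw [pow_succ]; rfl⟩

/-- Every B-Fredholm operator is of topological uniform descent. -/
theorem IsBFredholm.isTopologicalUniformDescent {S : X →L[ℂ] X} (h : IsBFredholm S) :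
    IsTopologicalUniformDescent S := by
  obtain ⟨n, hcl, hF⟩ := h
  have hfin : FiniteDimensional ℂ (S.ker ⊓ (S ^ n).range : Submodule ℂ X) := by
    have := hF.finite_ker
    have e : (S.ker ⊓ (S ^ n).range : Submodule ℂ X) =
        (restrictRangePow S n).ker.map (S ^ n).range.subtype := by
      ext x
      constructor
      · rintro ⟨hx, hx'⟩
        exact ⟨⟨x, hx'⟩, Subtype.ext hx, rfl⟩
      · rintro ⟨y, hy, rfl⟩
        exact ⟨congr(($hy : X)), y.2⟩
    rw [e]
    infer_instance
  -- The spaces `N(S) ∩ R(S ^ (n + k))` decrease inside a finite-dimensional one, hence stabilise.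
  let f : ℕ → Submodule ℂ (S.ker ⊓ (S ^ n).range : Submodule ℂ X) := fun k =>
    (S ^ (n + k)).range.comap (Submodule.subtype _)
  have hf : Antitone f := fun a b hab =>
    Submodule.comap_mono (range_pow_antitone S (by omega : n + a ≤ n + b))
  obtain ⟨k, hk⟩ := IsArtinian.monotone_stabilizes (⟨f, hf⟩ : ℕ →o (Submodule ℂ _)ᵒᵈ)
  have hstep : ∀ m, n + k ≤ m → ∀ x, S x = 0 → x ∈ (S ^ m).range → x ∈ (S ^ (m + 1)).range := by
    intro m hm x hx hxm
    obtain ⟨l, rfl⟩ := Nat.exists_eq_add_of_le hm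
    have e : f (k + l) = f (k + l + 1) :=
      (hk (k + l) (by omega)).symm.trans (hk (k + l + 1) (by omega))
    have hxn : x ∈ (S ^ n).range := range_pow_antitone S (by omega : n ≤ n + k + l) hxm
    have h1 : (⟨x, hx, hxn⟩ : (S.ker ⊓ (S ^ n).range : Submodule ℂ X)) ∈ f (k + l) := by
      change x ∈ (S ^ (n + (k + l))).range
      rwa [← add_assoc]
    rw [e] at h1
    change x ∈ (S ^ (n + (k + l + 1))).range at h1
    rwa [← add_assoc, ← add_assoc] at h1
  refine ⟨n + k, fun m hm => ?_, ?_⟩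
  · induction m, hm using Nat.le_induction with
    | base => rfl
    | succ m hm ih =>
      rw [← ih]
      apply le_antisymm
      · refine sup_le le_sup_left fun x hx => ?_
        have hx1 : S ((S ^ m) x) = 0 := by
          have : (S ^ (m + 1)) x = 0 := hx
          rwa [pow_succ'] at this
        -- `S ^ m x` lies in `N(S) ∩ R(S ^ m)`, hence equals `S ^ (m + 1) y`, and `x - S y` is in
        -- `N(S ^ m)`.
        obtain ⟨y, hy⟩ := hstep m hm _ hx1 ⟨x, rfl⟩
        refine Submodule.mem_sup.mpr ⟨S y, ⟨y, rfl⟩, x - S y, ?_, by abel⟩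
        change (S ^ m) (x - S y) = 0
        have hy' : (S ^ m) (S y) = (S ^ m) x := by rw [← hy, pow_succ]; rfl
        rw [map_sub, hy', sub_self]
      · refine sup_le_sup_left (fun x hx => ?_) _
        have hx : (S ^ m) x = 0 := hx
        change (S ^ (m + 1)) x = 0
        rw [pow_succ']
        change S ((S ^ m) x) = 0
        rw [hx, map_zero]
  -- The sum is the preimage under `S ^ (n + k)` of the closed range of the next power.
  · have e : ((S.range ⊔ (S ^ (n + k)).ker : Submodule ℂ X) : Set X) =
        (S ^ (n + k)) ⁻¹' ((S ^ (k + 1 + n)).range : Set X) := by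
      have e1 : S ^ (k + 1 + n) = S ^ (n + k) * S := by rw [← pow_succ]; congr 1; omega
      ext x
      rw [e1]
      constructor
      · intro hx
        obtain ⟨_, ⟨y, rfl⟩, z, hz, rfl⟩ := Submodule.mem_sup.mp hx
        have hz : (S ^ (n + k)) z = 0 := hz
        refine ⟨y, ?_⟩
        change (S ^ (n + k)) (S y) = (S ^ (n + k)) (S y + z)
        rw [map_add, hz, add_zero]
      · rintro ⟨y, hy⟩
        have hy : (S ^ (n + k)) (S y) = (S ^ (n + k)) x := hy
        refine Submodule.mem_sup.mpr ⟨S y, ⟨y, rfl⟩, x - S y, ?_, by abel⟩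
        change (S ^ (n + k)) (x - S y) = 0
        rw [map_sub, hy, sub_self]
    rw [e]
    exact (isClosed_range_pow_of_isFredholm hcl hF (k + 1)).preimage (S ^ (n + k)).continuous

theorem exists_commute_pow_eq_of_mem_finitePoleClass {T : X →L[ℂ] X} (hT : T ∈ finitePoleClass X)
    (μ : ℂ) : ∃ (p : ℕ) (Q : X →L[ℂ] X), Commute (T - μ • (1 : X →L[ℂ] X)) Q ∧
      (T - μ • (1 : X →L[ℂ] X)) ^ p = (T - μ • (1 : X →L[ℂ] X)) ^ (p + 1) * Q := by
  by_cases hμ : μ ∈ spectrum ℂ T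
  · refine exists_commute_pow_eq_of_meromorphicAt T μ (hT.2 μ hμ).1 ?_
    have h1 := (hT.1.subset (Set.sdiff_subset (t := {μ}))).isClosed.isOpen_compl.mem_nhds
      (x := μ) (by simp)
    filter_upwards [nhdsWithin_le_nhds h1, self_mem_nhdsWithin] with z hz hzμ hzs
    exact hz ⟨hzs, hzμ⟩
  · obtain ⟨u, hu⟩ : IsUnit (T - μ • (1 : X →L[ℂ] X)) := by
      have := (spectrum.notMem_iff.mp hμ).neg
      rwa [neg_sub, Algebra.algebraMap_eq_smul_one] at this
    refine ⟨0, ((u⁻¹ : (X →L[ℂ] X)ˣ) : X →L[ℂ] X), ?_, ?_⟩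
    · rw [← hu]; exact (Commute.refl _).units_inv_right
    · rw [← hu]; simp

end DrazinBFredholm

/-! ### From uniform descent to poles -/

section UniformDescent

variable {X Y : Type*} [NormedAddCommGroup X] [NormedSpace ℂ X]
  [NormedAddCommGroup Y] [NormedSpace ℂ Y] [CompleteSpace Y]

/-- A semi-regular operator of which arbitrarily small translates are invertible is injective. -/
theorem injective_of_ker_pow_le_range {A : Y →L[ℂ] Y} (hcl : IsClosed (A.range : Set Y))
    (hker : ∀ n, (A ^ n).ker ≤ A.range)
    (hfreq : ∃ᶠ μ in 𝓝 (0 : ℂ), IsUnit (A - μ • (1 : Y →L[ℂ] Y))) : Function.Injective A := by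
  have hcompl : CompleteSpace A.range := hcl.completeSpace_coe
  obtain ⟨C, hC0, hC⟩ : ∃ C > 0, ∀ y ∈ A.range, ∃ x, A x = y ∧ ‖x‖ ≤ C * ‖y‖ := by
    obtain ⟨C, hC0, hC⟩ := ContinuousLinearMap.exists_preimage_norm_le
      (A.codRestrict A.range fun x => ⟨x, rfl⟩) (by rintro ⟨_, x, rfl⟩; exact ⟨x, rfl⟩)
    refine ⟨C, hC0, fun y hy => ?_⟩
    obtain ⟨x, hx, hx'⟩ := hC ⟨y, hy⟩
    exact ⟨x, congr(($hx : Y)), hx'⟩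
  rw [injective_iff_map_eq_zero]
  intro x hx
  choose! g hg hgn using hC
  -- A backward orbit of `x` with geometric growth: each `u n` lies in `N(A ^ (n + 1))`, hence in
  -- the range, so a bounded preimage can be chosen again.
  let u : ℕ → Y := fun n => g^[n] x
  have hu : ∀ n, u (n + 1) = g (u n) := fun n => Function.iterate_succ_apply' g n x
  have hmem : ∀ n, (A ^ (n + 1)) (u n) = 0 := by
    intro n
    induction n with
    | zero => simpa [u] using hx
    | succ n ih =>
      rw [pow_succ, hu]
      change (A ^ (n + 1)) (A (g (u n))) = 0
      rw [hg _ (hker (n + 1) ih), ih]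
  have hA : ∀ n, A (u (n + 1)) = u n := fun n => by
    rw [hu, hg _ (hker (n + 1) (hmem n))]
  have hn : ∀ n, ‖u n‖ ≤ C ^ n * ‖x‖ := by
    intro n
    induction n with
    | zero => simp [u]
    | succ n ih =>
      rw [hu, pow_succ', mul_assoc]
      exact (hgn _ (hker (n + 1) (hmem n))).trans (by gcongr)
  have hr : (0 : ℝ) < (2 * C)⁻¹ := by positivity
  have hterm : ∀ μ : ℂ, ‖μ‖ ≤ (2 * C)⁻¹ → ∀ n, ‖μ ^ n • u n‖ ≤ (1 / 2) ^ n * ‖x‖ := by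
    intro μ hμ n
    rw [norm_smul, norm_pow]
    calc ‖μ‖ ^ n * ‖u n‖ ≤ ((2 * C)⁻¹) ^ n * (C ^ n * ‖x‖) := by gcongr; exact hn n
      _ = (1 / 2) ^ n * ‖x‖ := by rw [← mul_assoc, ← mul_pow]; congr 2; field_simp
  have hsum : Summable fun n : ℕ => (1 / 2 : ℝ) ^ n * ‖x‖ :=
    (summable_geometric_of_lt_one (by norm_num) (by norm_num)).mul_right _
  have hS : ∀ μ : ℂ, ‖μ‖ ≤ (2 * C)⁻¹ → Summable fun n => μ ^ n • u n := fun μ hμ =>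
    .of_norm_bounded hsum (hterm μ hμ)
  have hball : Metric.closedBall (0 : ℂ) (2 * C)⁻¹ ∈ 𝓝 (0 : ℂ) := Metric.closedBall_mem_nhds _ hr
  -- `f` satisfies `A (f μ) = μ • f μ` and `f 0 = x`. It vanishes wherever `A - μ` is injective, so
  -- by continuity `x = 0`.
  let f : ℂ → Y := fun μ => ∑' n, μ ^ n • u n
  have hcont : ContinuousAt f 0 := by
    refine ContinuousOn.continuousAt (s := Metric.closedBall (0 : ℂ) (2 * C)⁻¹) ?_ hball
    exact continuousOn_tsum (fun n => by fun_prop) hsum fun n μ hμ =>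
      hterm μ (by simpa using hμ) n
  have hf0 : f 0 = x := by
    change ∑' n, (0 : ℂ) ^ n • u n = x
    rw [tsum_eq_single 0 fun n hn => by simp [hn]]
    simp [u]
  have hfA : ∀ μ : ℂ, ‖μ‖ ≤ (2 * C)⁻¹ → A (f μ) = μ • f μ := by
    intro μ hμ
    have h1 : A (f μ) = ∑' n, μ ^ n • A (u n) := by
      rw [A.map_tsum (hS μ hμ)]; simp
    have hs1 : Summable fun n => μ ^ n • A (u n) := by
      simpa using A.summable (hS μ hμ)
    rw [h1, hs1.tsum_eq_zero_add, ← tsum_const_smul'' μ]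
    have h2 : A (u 0) = 0 := hx
    simp [h2, hA, pow_succ', mul_smul]
  have hzero : ∃ᶠ μ in 𝓝 (0 : ℂ), f μ = 0 := by
    refine (hfreq.and_eventually hball).mono fun μ hμ => ?_
    obtain ⟨hu, hμ⟩ := hμ
    have hinj := (ContinuousLinearMap.isUnit_iff_bijective.mp hu).1
    apply hinj
    rw [map_zero]
    change A (f μ) - μ • f μ = 0
    rw [hfA μ (by simpa using hμ), sub_self]
  have := isClosed_singleton.mem_of_frequently_of_tendsto
    (hzero.mono fun _ h => Set.mem_singleton_iff.mpr h) hcont.tendsto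
  rw [← hf0]
  exact this

/-- An injective operator with closed range of which arbitrarily small translates are invertible is
invertible. -/
theorem isUnit_of_injective_of_isClosed_range {A : Y →L[ℂ] Y} (hcl : IsClosed (A.range : Set Y))
    (hinj : Function.Injective A)
    (hfreq : ∃ᶠ μ in 𝓝 (0 : ℂ), IsUnit (A - μ • (1 : Y →L[ℂ] Y))) : IsUnit A := by
  obtain ⟨K, hK⟩ := A.antilipschitz_of_injective_of_isClosed_range hinj hcl
  have hb : ∀ x, ‖x‖ ≤ K * ‖A x‖ := fun x => by simpa using hK.le_mul_dist x 0
  have hball : Metric.ball (0 : ℂ) (2 * K + 1)⁻¹ ∈ 𝓝 (0 : ℂ) :=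
    Metric.ball_mem_nhds _ (by positivity)
  obtain ⟨μ, ⟨u, hu⟩, hμ⟩ := (hfreq.and_eventually hball).exists
  have hμ : ‖μ‖ < (2 * K + 1)⁻¹ := by simpa using hμ
  have hμ' : ‖μ‖ * (2 * K + 1) < 1 := by rwa [← lt_div_iff₀ (by positivity), one_div]
  -- For `x = u⁻¹ y`, `‖x‖ ≤ K (‖y‖ + ‖μ‖ ‖x‖)` with `K ‖μ‖ < 1 / 2`. Then `‖μ • u⁻¹‖ < 1`, and `A =
  -- u (1 + μ • u⁻¹)` is invertible by a Neumann series.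
  have hinv : ‖((u⁻¹ : (Y →L[ℂ] Y)ˣ) : Y →L[ℂ] Y)‖ ≤ 2 * K := by
    refine ContinuousLinearMap.opNorm_le_bound _ (by positivity) fun y => ?_
    set x := ((u⁻¹ : (Y →L[ℂ] Y)ˣ) : Y →L[ℂ] Y) y
    have hx : A x - μ • x = y := by
      have h1 : (u : Y →L[ℂ] Y) * ((u⁻¹ : (Y →L[ℂ] Y)ˣ) : Y →L[ℂ] Y) = 1 := u.mul_inv
      rw [hu] at h1
      exact congr($h1 y)
    have h2 : ‖A x‖ ≤ ‖y‖ + ‖μ‖ * ‖x‖ := by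
      rw [← norm_smul, ← hx]; simpa using norm_add_le (A x - μ • x) (μ • x)
    have h3 := hb x
    have hK0 : (0 : ℝ) ≤ K := K.2
    nlinarith [norm_nonneg x, norm_nonneg μ, norm_nonneg y, mul_le_mul_of_nonneg_left h2 hK0,
      mul_nonneg (norm_nonneg μ) (norm_nonneg x)]
  have hA : A = u * (1 - (-(μ • ((u⁻¹ : (Y →L[ℂ] Y)ˣ) : Y →L[ℂ] Y)))) := by
    rw [sub_neg_eq_add, mul_add, mul_one, mul_smul_comm, u.mul_inv, hu]; abel
  rw [hA]
  refine u.isUnit.mul (isUnit_one_sub_of_norm_lt_one ?_)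
  rw [norm_neg, norm_smul]
  have := mul_le_mul_of_nonneg_left hinv (norm_nonneg μ)
  nlinarith [norm_nonneg μ]

/-- If `S` has topological uniform descent for `n ≥ d` and arbitrarily small invertible translates,
the operator `A` it induces on `X / N(S ^ d)` is invertible. -/
theorem isUnit_of_hasUniformDescent [CompleteSpace X] {S : X →L[ℂ] X} {d : ℕ} {A : Y →L[ℂ] Y} {π : X →L[ℂ] Y}
    {j : Y →L[ℂ] X} (hπ : Function.Surjective π) (hj : Function.Injective j)
    (hA : ∀ x, π (S x) = A (π x)) (hjA : ∀ y, S (j y) = j (A y)) (hjπ : ∀ x, j (π x) = (S ^ d) x)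
    (hd : HasUniformDescent S d)
    (hcl : IsClosed ((S.range ⊔ (S ^ d).ker : Submodule ℂ X) : Set X))
    (hfreq : ∃ᶠ μ in 𝓝 (0 : ℂ), IsUnit (S - μ • (1 : X →L[ℂ] X))) : IsUnit A := by
  have hkerπ : ∀ x, π x = 0 ↔ (S ^ d) x = 0 := fun x => by
    rw [← hjπ, map_eq_zero_iff j hj]
  have hpow : ∀ n x, (A ^ n) (π x) = π ((S ^ n) x) := by
    intro n
    induction n with
    | zero => intro x; rfl
    | succ n ih =>
      intro x
      rw [pow_succ, pow_succ]
      change (A ^ n) (A (π x)) = π ((S ^ n) (S x))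
      rw [← hA, ih]
  have hrange : ∀ x, π x ∈ A.range ↔ x ∈ S.range ⊔ (S ^ d).ker := by
    intro x
    constructor
    · rintro ⟨y, hy⟩
      obtain ⟨z, rfl⟩ := hπ y
      have hy : A (π z) = π x := hy
      refine Submodule.mem_sup.mpr ⟨S z, ⟨z, rfl⟩, x - S z, ?_, by abel⟩
      exact (hkerπ _).mp (by rw [map_sub, hA, hy, sub_self])
    · intro hx
      obtain ⟨_, ⟨y, rfl⟩, z, hz, rfl⟩ := Submodule.mem_sup.mp hx
      refine ⟨π y, ?_⟩
      have hz : π z = 0 := (hkerπ z).mpr hz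
      change A (π y) = π (S y + z)
      rw [map_add, hz, add_zero, hA]
  have hclA : IsClosed (A.range : Set Y) := by
    rw [← (π.isQuotientMap hπ).isClosed_preimage]
    convert hcl using 1
    ext x
    exact hrange x
  -- Injectivity of `A - μ` is inherited through the embedding `j`, surjectivity through the
  -- quotient map `π`.
  have hfreqA : ∃ᶠ μ in 𝓝 (0 : ℂ), IsUnit (A - μ • (1 : Y →L[ℂ] Y)) := by
    refine hfreq.mono fun μ hμ => ?_
    rw [ContinuousLinearMap.isUnit_iff_bijective] at hμ ⊢
    constructor
    · rw [injective_iff_map_eq_zero]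
      intro y hy
      have hy : A y - μ • y = 0 := hy
      apply hj
      apply hμ.1
      rw [map_zero, map_zero]
      change S (j y) - μ • j y = 0
      rw [hjA, ← map_smul, ← map_sub, hy, map_zero]
    · intro y
      obtain ⟨x, rfl⟩ := hπ y
      obtain ⟨z, rfl⟩ := hμ.2 x
      refine ⟨π z, ?_⟩
      change A (π z) - μ • π z = π (S z - μ • z)
      rw [map_sub, map_smul, hA]
  refine isUnit_of_injective_of_isClosed_range hclA
    (injective_of_ker_pow_le_range hclA (fun n y hy => ?_) hfreqA) hfreqA
  obtain ⟨x, rfl⟩ := hπ y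
  -- Uniform descent enters here: `π x` in `N(A ^ n)` means `x` in `N(S ^ (d + n))`, which lies in
  -- `R(S) + N(S ^ d)`.
  rw [hrange, ← hd (d + n) (Nat.le_add_right d n)]
  refine (le_sup_right : (S ^ (d + n)).ker ≤ _) ?_
  have hy : (A ^ n) (π x) = 0 := hy
  rw [hpow, hkerπ] at hy
  change (S ^ (d + n)) x = 0
  rw [pow_add]
  exact hy

/-- If `T - μ` induces an invertible operator on `X / N((T - μ) ^ d)`, then `μ` is at most an
isolated point of the spectrum and the resolvent is meromorphic there. -/
theorem meromorphicAt_resolvent_of_isUnit {T : X →L[ℂ] X} {μ : ℂ} {d : ℕ} {A : Y →L[ℂ] Y}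
    {π : X →L[ℂ] Y} {j : Y →L[ℂ] X} (hu : IsUnit A)
    (hA : ∀ x, π ((T - μ • (1 : X →L[ℂ] X)) x) = A (π x))
    (hjA : ∀ y, (T - μ • (1 : X →L[ℂ] X)) (j y) = j (A y))
    (hjπ : ∀ x, j (π x) = ((T - μ • (1 : X →L[ℂ] X)) ^ d) x) :
    MeromorphicAt (resolvent T : ℂ → X →L[ℂ] X) μ ∧ ∀ᶠ z in 𝓝[≠] μ, z ∉ spectrum ℂ T := by
  set S := T - μ • (1 : X →L[ℂ] X) with hS
  let E : ℂ → X →L[ℂ] X := fun w =>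
    -- `(w - S) * E w = w ^ d - S ^ d`; the term `j (B z)⁻¹ π` of `H` supplies the missing `S ^ d`,
    -- so `H z` is `(z - μ) ^ d` times the resolvent.
    ∑ i ∈ Finset.range d, (w • (1 : X →L[ℂ] X)) ^ i * S ^ (d - 1 - i)
  let B : ℂ → Y →L[ℂ] Y := fun z => (z - μ) • (1 : Y →L[ℂ] Y) - A
  let H : ℂ → X →L[ℂ] X := fun z => E (z - μ) + j ∘L Ring.inverse (B z) ∘L π
  have hBμ : B μ = -A := by simp [B]
  have hB : AnalyticAt ℂ B μ := by fun_prop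
  have hBu : ∀ᶠ z in 𝓝 μ, IsUnit (B z) :=
    hB.continuousAt.eventually (Units.isOpen.mem_nhds (by rw [hBμ]; exact hu.neg))
  have hinv : AnalyticAt ℂ (fun z => Ring.inverse (B z)) μ := by
    obtain ⟨u, hu'⟩ := hu.neg
    exact (analyticAt_inverse (𝕜 := ℂ) (A := Y →L[ℂ] Y) u).comp_of_eq hB (by rw [hBμ, hu'])
  have hH : AnalyticAt ℂ H μ := by
    refine AnalyticAt.add (by fun_prop) ?_
    exact ((ContinuousLinearMap.compL ℂ X Y X j).comp
      ((ContinuousLinearMap.compL ℂ X Y Y).flip π)).analyticAt _ |>.comp hinv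
  have hc : ∀ w : ℂ, Commute (w • (1 : X →L[ℂ] X)) S := fun w => (Commute.one_left S).smul_left w
  have hev : ∀ᶠ z in 𝓝[≠] μ, IsUnit (algebraMap ℂ (X →L[ℂ] X) z - T) ∧
      resolvent T z = ((z - μ) ^ d)⁻¹ • H z := by
    filter_upwards [hBu.filter_mono nhdsWithin_le_nhds, self_mem_nhdsWithin] with z hz hzμ
    have hw : (z - μ) ^ d ≠ 0 := pow_ne_zero _ (sub_ne_zero.mpr hzμ)
    have e : algebraMap ℂ (X →L[ℂ] X) z - T = (z - μ) • (1 : X →L[ℂ] X) - S := by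
      rw [Algebra.algebraMap_eq_smul_one, hS, sub_smul]; abel
    have hl : ((z - μ) • (1 : X →L[ℂ] X) - S) * H z = (z - μ) ^ d • 1 := by
      have h1 : ((z - μ) • (1 : X →L[ℂ] X) - S) * E (z - μ) = (z - μ) ^ d • 1 - S ^ d := by
        rw [(hc _).mul_geom_sum₂ d, smul_pow, one_pow]
      have h2 : ((z - μ) • (1 : X →L[ℂ] X) - S) * (j ∘L Ring.inverse (B z) ∘L π) = S ^ d := by
        ext x
        have h3 := congr($(Ring.mul_inverse_cancel _ hz) (π x))
        have h3 : (z - μ) • Ring.inverse (B z) (π x) - A (Ring.inverse (B z) (π x)) = π x := h3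
        change (z - μ) • j (Ring.inverse (B z) (π x)) - S (j (Ring.inverse (B z) (π x))) = _
        rw [hjA, ← map_smul, ← map_sub, h3, hjπ]
      rw [mul_add, h1, h2, sub_add_cancel]
    have hr : H z * ((z - μ) • (1 : X →L[ℂ] X) - S) = (z - μ) ^ d • 1 := by
      have h1 : E (z - μ) * ((z - μ) • (1 : X →L[ℂ] X) - S) = (z - μ) ^ d • 1 - S ^ d := by
        rw [(hc _).geom_sum₂_mul d, smul_pow, one_pow]
      have h2 : (j ∘L Ring.inverse (B z) ∘L π) * ((z - μ) • (1 : X →L[ℂ] X) - S) = S ^ d := by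
        ext x
        have h3 := congr($(Ring.inverse_mul_cancel _ hz) (π x))
        have h3 : Ring.inverse (B z) ((z - μ) • π x - A (π x)) = π x := h3
        change j (Ring.inverse (B z) (π ((z - μ) • x - S x))) = _
        rw [map_sub, map_smul, hA, h3, hjπ]
      rw [add_mul, h1, h2, sub_add_cancel]
    have hl' : ((z - μ) • (1 : X →L[ℂ] X) - S) * (((z - μ) ^ d)⁻¹ • H z) = 1 := by
      rw [mul_smul_comm, hl, inv_smul_smul₀ hw]
    have hr' : (((z - μ) ^ d)⁻¹ • H z) * ((z - μ) • (1 : X →L[ℂ] X) - S) = 1 := by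
      rw [smul_mul_assoc, hr, inv_smul_smul₀ hw]
    rw [resolvent, e]
    exact ⟨⟨⟨_, _, hl', hr'⟩, rfl⟩, Ring.inverse_unit ⟨_, _, hl', hr'⟩⟩
  refine ⟨?_, hev.mono fun z hz => spectrum.notMem_iff.mpr hz.1⟩
  have hmer : MeromorphicAt (fun z => ((z - μ) ^ d)⁻¹ • H z) μ := by
    have hpow : MeromorphicAt (fun z : ℂ => (z - μ) ^ d) μ := by fun_prop
    exact hpow.inv.smul hH.meromorphicAt
  exact hmer.congr (hev.mono fun z hz => hz.2.symm)

/-- At a frontier point of the spectrum where `T - μ` is of topological uniform descent, the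
resolvent has an isolated, at most polar, singularity. -/
theorem IsTopologicalUniformDescent.meromorphicAt_resolvent [CompleteSpace X] {T : X →L[ℂ] X} {μ : ℂ}
    (h : IsTopologicalUniformDescent (T - μ • (1 : X →L[ℂ] X))) (hμ : μ ∈ frontier (spectrum ℂ T)) :
    MeromorphicAt (resolvent T : ℂ → X →L[ℂ] X) μ ∧ ∀ᶠ z in 𝓝[≠] μ, z ∉ spectrum ℂ T := by
  obtain ⟨d, hd, hcl⟩ := h
  set S := T - μ • (1 : X →L[ℂ] X) with hS
  have hfreq : ∃ᶠ w in 𝓝 (0 : ℂ), IsUnit (S - w • (1 : X →L[ℂ] X)) := by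
    have h1 : ∃ᶠ z in 𝓝 μ, z ∉ spectrum ℂ T := by
      rw [frontier_eq_closure_inter_closure] at hμ
      exact mem_closure_iff_frequently.mp hμ.2
    have h2 : Tendsto (fun z : ℂ => z - μ) (𝓝 μ) (𝓝 0) := by
      have : Tendsto (fun z : ℂ => z - μ) (𝓝 μ) (𝓝 (μ - μ)) := Continuous.tendsto (by fun_prop) μ
      rwa [sub_self] at this
    refine h2.frequently (h1.mono fun z hz => ?_)
    have e : S - (z - μ) • (1 : X →L[ℂ] X) = -(algebraMap ℂ (X →L[ℂ] X) z - T) := by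
      rw [Algebra.algebraMap_eq_smul_one, hS, sub_smul]; abel
    rw [e]
    exact (spectrum.notMem_iff.mp hz).neg
  let N := (S ^ d).ker
  have hN : IsClosed (N : Set X) := (S ^ d).isClosed_ker
  have hSN : N ≤ (N.mkQL ∘L S).ker := by
    intro x hx
    have hx : (S ^ d) x = 0 := hx
    change N.mkQ (S x) = 0
    rw [Submodule.mkQ_apply, Submodule.Quotient.mk_eq_zero]
    change (S ^ d * S) x = 0
    rw [← pow_succ, pow_succ']
    change S ((S ^ d) x) = 0
    rw [hx, map_zero]
  let A : (X ⧸ N) →L[ℂ] (X ⧸ N) := N.liftQL (N.mkQL ∘L S) hSN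
  let j : (X ⧸ N) →L[ℂ] X := N.liftQL (S ^ d) le_rfl
  have hπ : Function.Surjective N.mkQL := N.mkQ_surjective
  have hA : ∀ x, N.mkQL (S x) = A (N.mkQL x) := fun x => rfl
  have hjπ : ∀ x, j (N.mkQL x) = (S ^ d) x := fun x => rfl
  have hjA : ∀ y, S (j y) = j (A y) := by
    intro y
    obtain ⟨x, rfl⟩ := hπ y
    rw [← hA, hjπ, hjπ]
    change (S * S ^ d) x = (S ^ d * S) x
    rw [← pow_succ, ← pow_succ']
  have hj : Function.Injective j := by
    rw [injective_iff_map_eq_zero]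
    intro y hy
    obtain ⟨x, rfl⟩ := hπ y
    exact (Submodule.Quotient.mk_eq_zero N).mpr hy
  exact meromorphicAt_resolvent_of_isUnit
    (isUnit_of_hasUniformDescent hπ hj hA hjA hjπ hd hcl hfreq) hA hjA hjπ

theorem mem_finitePoleClass_of_tudSpectrum_eq_empty [CompleteSpace X] {T : X →L[ℂ] X} (h : tudSpectrum T = ∅) :
    T ∈ finitePoleClass X := by
  have hT : ∀ μ : ℂ, IsTopologicalUniformDescent (T - μ • (1 : X →L[ℂ] X)) := fun μ => by
    by_contra hμ
    exact Set.eq_empty_iff_forall_notMem.mp h μ hμ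
  have hfr := fun μ hμ => (hT μ).meromorphicAt_resolvent hμ
  obtain ⟨hfin, hsub⟩ := finite_and_subset_frontier_of_isolated (spectrum.isCompact (𝕜 := ℂ) T)
    fun μ hμ => (hfr μ hμ).2
  exact ⟨hfin, fun μ hμ => ⟨(hfr μ (hsub hμ)).1,
    meromorphicOrderAt_resolvent_neg hμ (hfr μ (hsub hμ)).1 (hfr μ (hsub hμ)).2⟩⟩

end UniformDescent

theorem mainTheorem10 {X : Type*} [NormedAddCommGroup X] [NormedSpace ℂ X] [CompleteSpace X] :
    finitePoleClass X = {T : X →L[ℂ] X | tudSpectrum T = ∅} ∧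
      finitePoleClass X = {T : X →L[ℂ] X | bFredholmSpectrum T = ∅} := by
  refine ⟨Set.Subset.antisymm (fun T hT => ?_) fun T hT =>
    mem_finitePoleClass_of_tudSpectrum_eq_empty hT,
    Set.Subset.antisymm (fun T hT => ?_) fun T hT =>
      mem_finitePoleClass_of_tudSpectrum_eq_empty ?_⟩
  · refine Set.eq_empty_iff_forall_notMem.mpr fun μ hμ => hμ ?_
    obtain ⟨p, Q, -, h⟩ := exists_commute_pow_eq_of_mem_finitePoleClass hT μ
    exact isTopologicalUniformDescent_of_pow_eq h
  · refine Set.eq_empty_iff_forall_notMem.mpr fun μ hμ => hμ ?_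
    obtain ⟨p, Q, hc, h⟩ := exists_commute_pow_eq_of_mem_finitePoleClass hT μ
    exact isBFredholm_of_pow_eq hc h
  · refine Set.eq_empty_iff_forall_notMem.mpr fun μ hμ => ?_
    exact Set.eq_empty_iff_forall_notMem.mp hT μ fun hB => hμ hB.isTopologicalUniformDescent
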